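/- All rings are commutative, unital and Noetherian, and modules are over such rings. Let $(R,\mathfrak m)$ be a local ring. Its depth is the common length of the maximal $R$-regular sequences in $\mathfrak m$, and $R$ is Cohen–Macaulay if $\operatorname{depth} R=\dim R$. An ideal $I$ of a local ring $(S,\mathfrak n)$ is a Burch ideal if $\mathfrak n I\neq \mathfrak n(I:_S\mathfrak n)$. A local ring $R$ of depth $t$, with $\mathfrak m$-adic completion $\widehat R$, is a Burch ring if there exist a maximal $\widehat R$-regular sequence $x_1,\dots,x_t$ in $\widehat R$, a regular local ring $S$ and a Burch ideal $I$ of $S$ such that $\widehat R/(x_1,\dots,x_t)\cong S/I$ as rings. **Theorem** (the Auslander–Reiten conjecture holds for Cohen–Macaulay Burch rings). Let $R$ be a Cohen–Macaulay local ring which is a Burch ring, and let $M$ be a finitely generated $R$-module such that $\operatorname{Ext}^j_R(M,M)=0$ and $\operatorname{Ext}^j_R(M,R)=0$ for all $j>0$. Then $M$ is free. -/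

import Mathlib

universe u

open IsLocalRing

/-- The depth of a local ring `R`: the supremum of the lengths of the `R`-regular sequences
contained in the maximal ideal. -/
noncomputable def localRingDepth (R : Type u) [CommRing R] [IsLocalRing R] : ℕ∞ :=
  ⨆ (rs : List R) (_ : RingTheory.Sequence.IsRegular R rs ∧ ∀ r ∈ rs, r ∈ maximalIdeal R),
    (rs.length : ℕ∞)

/-- A Noetherian local ring is Cohen-Macaulay if its depth equals its Krull dimension. -/
def IsCohenMacaulayLocal (R : Type u) [CommRing R] [IsLocalRing R] [IsNoetherianRing R] : Prop :=
  (localRingDepth R : WithBot ℕ∞) = ringKrullDim R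

/-- An ideal `I` of a local ring `(S, 𝔫)` is a Burch ideal if `𝔫 I ≠ 𝔫 (I : 𝔫)`. -/
def IsBurchIdeal {S : Type u} [CommRing S] [IsLocalRing S] (I : Ideal S) : Prop :=
  maximalIdeal S * I ≠ maximalIdeal S * Submodule.colon I (maximalIdeal S : Set S)

/-- A finite sequence is a maximal `A`-regular sequence (in the local ring `A`) if it is an
`A`-regular sequence in the maximal ideal that cannot be extended to a longer one. -/
structure IsMaximalRegularSequence {A : Type u} [CommRing A] [IsLocalRing A]
    (rs : List A) : Prop where
  isRegular : RingTheory.Sequence.IsRegular A rs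
  mem_maximalIdeal : ∀ r ∈ rs, r ∈ maximalIdeal A
  not_extend : ∀ y ∈ maximalIdeal A, ¬ RingTheory.Sequence.IsRegular A (rs ++ [y])

/-- A Noetherian local ring `R` of depth `t` is a Burch ring if its `𝔪`-adic completion has a
maximal regular sequence `x₁, …, x_t` such that the quotient by it is isomorphic to `S / I` with
`S` a regular local ring and `I` a Burch ideal of `S`. (Such an `S` has the same residue field as
`R`, so taking `S` in the universe of `R` is no restriction.) -/
def IsBurchRing (R : Type u) [CommRing R] [IsLocalRing R] [IsNoetherianRing R] : Prop :=
  ∃ rs : List (AdicCompletion (maximalIdeal R) R),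
    (rs.length : ℕ∞) = localRingDepth R ∧
    IsMaximalRegularSequence rs ∧
    ∃ (S : Type u) (_ : CommRing S) (_ : IsRegularLocalRing S) (I : Ideal S),
      IsBurchIdeal I ∧
      Nonempty ((AdicCompletion (maximalIdeal R) R ⧸ Ideal.ofList rs) ≃+* (S ⧸ I))

-- Take a minimal free resolution `F` of `M`. Vanishing of Ext becomes exactness of the transposed
-- matrices (`MinRes.HomExact`), and freeness follows from `F.b 1 = 0`. In this form (`ARProperty`)
-- the statement passes from the completion to `R` by flat base change (`ARProperty.of_flat`) and
-- from `A / x` to `A` for a regular `x` (`ARProperty.of_regular`), so it suffices to treat `S / I`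
-- with `I` a Burch ideal. Minimality is only used as "entries in a proper ideal `𝔞`", so the
-- intermediate rings need not be shown local.
--
-- For `S / I` (`ARProperty.of_isBurchIdeal`), choose `x ∈ 𝔫` and `y ∈ (I : 𝔫)` with `x y ∉ 𝔫 I`.
-- Let `N ⊆ 𝔞 F₁` be the second syzygy; it contains `y e_p`, which `𝔞` kills. If `F₄ ≠ 0`, sending
-- one basis vector of `F₄` to `y e_p` and the others to `0` is a cocycle, so `Ext²(N, N) = 0`
-- writes it as `ψ D₃`. As `x y = 0` in `S / I`, also `x ψ` is a cocycle, and `Ext¹(N, N) = 0` gives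
-- `x ψ = θ D₂`. After lifting to `S`, `x y` agrees modulo `𝔫 I` with an entry of `θ D₂ D₃`; this
-- lies in `𝔫 I`, since `θ` has entries in `𝔫` and `D₂ D₃` has entries in `I`. That is a
-- contradiction.

universe v

/-! ### Exactness of pairs of matrices with coefficients in a module. -/

section MatrixExactness

variable {A : Type u} [CommRing A]

/-- The pair of matrices `P`, `Q` is exact on the module `N`: each vector with entries in `N` killed
by `P` is of the form `Q w`. -/
def MatExact {p q r : Type*} [Fintype q] [Fintype r] (P : Matrix p q A) (Q : Matrix q r A)
    (N : Type v) [AddCommGroup N] [Module A N] : Prop :=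
  ∀ v : q → N, (∀ i, ∑ k, P i k • v k = 0) → ∃ w : r → N, ∀ k, v k = ∑ l, Q k l • w l

variable {p q r : Type*} [Fintype q] [Fintype r] {P : Matrix p q A} {Q : Matrix q r A}
  {K : Type*} [AddCommGroup K] [Module A K] {N : Type*} [AddCommGroup N] [Module A N]

theorem MatExact.of_linearEquiv (h : MatExact P Q N) (e : N ≃ₗ[A] K) : MatExact P Q K := by
  intro v hv
  obtain ⟨w, hw⟩ := h (fun k => e.symm (v k)) fun i => by
    simpa using congrArg e.symm (hv i)
  refine ⟨fun l => e (w l), fun k => ?_⟩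
  simpa using congrArg e (hw k)

theorem MatExact.pi {ι : Type*} (h : MatExact P Q N) : MatExact P Q (ι → N) := by
  intro v hv
  choose w hw using fun j : ι => h (fun k => v k j) fun i => by
    simpa using congrFun (hv i) j
  refine ⟨fun l j => w j l, fun k => ?_⟩
  ext j
  simpa using hw j k

/-- The action of a matrix on vectors with entries in a module. -/
def matAction (P : Matrix p q A) (N : Type*) [AddCommGroup N] [Module A N] :
    (q → N) →ₗ[A] (p → N) where
  toFun v i := ∑ k, P i k • v k
  map_add' v w := by ext i; simp [Finset.sum_add_distrib]
  map_smul' c v := by ext i; simp [Finset.smul_sum, smul_comm c]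

theorem matAction_mul_apply (hPQ : P * Q = 0) (w : r → N) (i : p) :
    ∑ k, P i k • ∑ l, Q k l • w l = 0 := by
  simp_rw [Finset.smul_sum, smul_smul]
  rw [Finset.sum_comm]
  simp_rw [← Finset.sum_smul]
  refine Finset.sum_eq_zero fun l _ => ?_
  have := congrFun (congrFun hPQ i) l
  rw [Matrix.mul_apply] at this
  rw [this]; simp

theorem MatExact.function_exact (hPQ : P * Q = 0) (h : MatExact P Q N) :
    Function.Exact (matAction Q N) (matAction P N) := by
  intro v
  constructor
  · intro hv
    obtain ⟨w, hw⟩ := h v fun i => congrFun hv i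
    exact ⟨w, by ext k; exact (hw k).symm⟩
  · rintro ⟨w, rfl⟩
    ext i
    exact matAction_mul_apply hPQ w i

open TensorProduct in
theorem piRight_lTensor_matAction {s t : Type*} [Fintype s] [Fintype t] [DecidableEq s]
    [DecidableEq t] {B : Type*} [CommRing B] [Algebra A B] (T : Matrix s t A)
    (z : B ⊗[A] (t → N)) (i : s) :
    TensorProduct.piRight A A B (fun _ : s => N) ((matAction T N).lTensor B z) i =
      ∑ k, algebraMap A B (T i k) • TensorProduct.piRight A A B (fun _ : t => N) z k := by
  induction z with
  | zero => simp
  | add a b ha hb => simp only [map_add, Pi.add_apply, ha, hb, smul_add, Finset.sum_add_distrib]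
  | tmul b f => simp [matAction, TensorProduct.tmul_sum]

open TensorProduct in
/-- Exactness of matrices is preserved by flat base change. -/
theorem MatExact.baseChange [Finite p] {B : Type*} [CommRing B] [Algebra A B]
    [Module.Flat A B] (hPQ : P * Q = 0) (h : MatExact P Q N) :
    MatExact (P.map (algebraMap A B)) (Q.map (algebraMap A B)) (B ⊗[A] N) := by
  classical
  have := Fintype.ofFinite p
  have ex := Module.Flat.lTensor_exact B (h.function_exact hPQ)
  intro v hv
  let z := (TensorProduct.piRight A A B (fun _ : q => N)).symm v
  have hz : (matAction P N).lTensor B z = 0 := by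
    apply (TensorProduct.piRight A A B (fun _ : p => N)).injective
    ext i
    rw [piRight_lTensor_matAction]
    simpa [z] using hv i
  obtain ⟨y, hy⟩ := (ex z).1 hz
  refine ⟨TensorProduct.piRight A A B (fun _ : r => N) y, fun k => ?_⟩
  have := piRight_lTensor_matAction Q y k
  rw [hy] at this
  simpa [z] using this

theorem matExact_map_iff {B : Type*} [CommRing B] [Algebra A B] [Module B N]
    [IsScalarTower A B N] :
    MatExact (P.map (algebraMap A B)) (Q.map (algebraMap A B)) N ↔ MatExact P Q N := by
  simp [MatExact]

end MatrixExactness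

/-! ### Minimal resolutions, syzygies and dimension shifting. -/

/-- A resolution by finite free modules, whose matrices have entries in the ideal `𝔞`. -/
structure MinRes (A : Type u) [CommRing A] (𝔞 : Ideal A) where
  b : ℕ → ℕ
  D : ∀ n, Matrix (Fin (b n)) (Fin (b (n + 1))) A
  mem : ∀ n i j, D n i j ∈ 𝔞
  mul_eq_zero : ∀ n, D n * D (n + 1) = 0
  exact : ∀ n, MatExact (D n) (D (n + 1)) A

namespace MinRes

variable {A : Type u} [CommRing A] {𝔞 : Ideal A} (F : MinRes A 𝔞)

/-- The module resolved by `F`. -/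
abbrev M : Type u := (Fin (F.b 0) → A) ⧸ LinearMap.range (F.D 0).mulVecLin

/-- The truncated resolution, which resolves the first syzygy. -/
def shift : MinRes A 𝔞 where
  b n := F.b (n + 1)
  D n := F.D (n + 1)
  mem n := F.mem (n + 1)
  mul_eq_zero n := F.mul_eq_zero (n + 1)
  exact n := F.exact (n + 1)

/-- Exactness in degree `j + 1` of the complex of homomorphisms from `F` to `N`. -/
def HomExact (N : Type*) [AddCommGroup N] [Module A N] (j : ℕ) : Prop :=
  MatExact (F.D (j + 1)).transpose (F.D j).transpose N

theorem transpose_mul (n : ℕ) : (F.D (n + 1)).transpose * (F.D n).transpose = 0 := by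
  rw [← Matrix.transpose_mul, F.mul_eq_zero, Matrix.transpose_zero]

section ShortExact

variable {F} {K : Type*} [AddCommGroup K] [Module A K] {P : Type*} [AddCommGroup P] [Module A P]
  {N : Type*} [AddCommGroup N] [Module A N] {f : K →ₗ[A] P} {g : P →ₗ[A] N}

/-- `F.HomExact N j` says `Ext^{j+1}(F.M, N) = 0`, so this is a stretch of the long exact sequence
of `0 → K → P → N → 0`. -/
theorem HomExact.left (hf : Function.Injective f) (hfg : Function.Exact f g)
    (hg : Function.Surjective g) {j : ℕ} (hN : F.HomExact N j) (hP : F.HomExact P (j + 1)) :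
    F.HomExact K (j + 1) := by
  intro φ hφ
  obtain ⟨ψ, hψ⟩ := hP (fun k => f (φ k)) fun i => by simpa using congrArg f (hφ i)
  obtain ⟨ω, hω⟩ := hN (fun k => g (ψ k)) fun i => by
    have h := congrArg g (hψ i)
    rw [hfg.apply_apply_eq_zero] at h
    simpa using h.symm
  choose ω' hω' using fun k => hg (ω k)
  -- Correcting `ψ` by a coboundary brings it into `K` without changing its own coboundary.
  choose κ hκ using fun k => (hfg (ψ k - ∑ l, (F.D j).transpose k l • ω' l)).1 (by
    simp [hω k, hω'])
  refine ⟨κ, fun k => hf ?_⟩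
  rw [hψ k]
  simp only [map_sum, map_smul, hκ, smul_sub, Finset.sum_sub_distrib]
  rw [matAction_mul_apply (F.transpose_mul j), sub_zero]

theorem HomExact.right (hf : Function.Injective f) (hfg : Function.Exact f g)
    (hg : Function.Surjective g) {j : ℕ} (hP : F.HomExact P j) (hK : F.HomExact K (j + 1)) :
    F.HomExact N j := by
  intro φ hφ
  choose φ' hφ' using fun k => hg (φ k)
  choose κ hκ using fun k => (hfg (∑ l, (F.D (j + 1)).transpose k l • φ' l)).1 (by
    simpa [hφ'] using hφ k)
  obtain ⟨l, hl⟩ := hK κ fun i => hf (by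
    simp only [map_sum, map_smul, hκ, map_zero]
    exact matAction_mul_apply (F.transpose_mul (j + 1)) _ _)
  obtain ⟨μ, hμ⟩ := hP (fun k => φ' k - f (l k)) fun i => by
    simp only [smul_sub, Finset.sum_sub_distrib]
    rw [← hκ, hl]
    simp
  refine ⟨fun k => g (μ k), fun k => ?_⟩
  have h := congrArg g (hμ k)
  simpa [hfg.apply_apply_eq_zero, hφ'] using h

end ShortExact

/-- The inclusion of the first syzygy into the free module in degree zero. -/
def syzygyMap : F.shift.M →ₗ[A] (Fin (F.b 0) → A) :=
  Submodule.liftQ _ (F.D 0).mulVecLin (by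
    rintro _ ⟨w, rfl⟩
    have h (w : Fin (F.b 2) → A) : (F.D 0).mulVec ((F.D 1).mulVec w) = 0 := by
      rw [Matrix.mulVec_mulVec, F.mul_eq_zero, Matrix.zero_mulVec]
    exact h w)

theorem syzygyMap_injective : Function.Injective F.syzygyMap := by
  rw [injective_iff_map_eq_zero]
  intro z hz
  obtain ⟨v, rfl⟩ := Submodule.Quotient.mk_surjective _ z
  change (F.D 0).mulVec v = 0 at hz
  obtain ⟨w, hw⟩ := F.exact 0 v fun i => congrFun hz i
  refine (Submodule.Quotient.mk_eq_zero _).2 ⟨w, ?_⟩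
  ext k
  exact (hw k).symm

theorem syzygyMap_exact :
    Function.Exact F.syzygyMap (Submodule.mkQ (LinearMap.range (F.D 0).mulVecLin)) := by
  intro v
  rw [Submodule.mkQ_apply, Submodule.Quotient.mk_eq_zero]
  constructor
  · rintro ⟨w, rfl⟩
    exact ⟨Submodule.Quotient.mk w, rfl⟩
  · rintro ⟨z, rfl⟩
    obtain ⟨w, rfl⟩ := Submodule.Quotient.mk_surjective _ z
    exact ⟨w, rfl⟩

/-- Self-orthogonality passes to the syzygy by the sequence `0 → ΩM → F₀ → M → 0`; `F.shift.HomExact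
K j` unfolds to `F.HomExact K (j + 1)`. -/
theorem homExact_shift (hM : ∀ j, F.HomExact F.M j) (hA : ∀ j, F.HomExact A j) (j : ℕ) :
    F.shift.HomExact F.shift.M j :=
  HomExact.left (F := F) F.syzygyMap_injective F.syzygyMap_exact (Submodule.mkQ_surjective _)
    (hM j) (MatExact.pi (hA (j + 1)))

theorem syzygyMap_mem (z : F.shift.M) (i : Fin (F.b 0)) : F.syzygyMap z i ∈ 𝔞 := by
  obtain ⟨v, rfl⟩ := Submodule.Quotient.mk_surjective _ z
  change ∑ k, F.D 0 i k * v k ∈ 𝔞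
  exact Ideal.sum_mem _ fun k _ => Ideal.mul_mem_right _ _ (F.mem _ _ _)

/-- If the resolution stops in positive degree, it stops one step earlier. -/
theorem b_eq_zero_of_succ (ha : 𝔞 ≠ ⊤) (hA : ∀ j, F.HomExact A j) {j : ℕ}
    (h : F.b (j + 2) = 0) : F.b (j + 1) = 0 := by
  by_contra hb
  let q : Fin (F.b (j + 1)) := ⟨0, Nat.pos_of_ne_zero hb⟩
  -- With no next term, a coordinate functional is a cocycle, hence a coboundary; its coefficient
  -- `1` would then lie in `𝔞`.
  obtain ⟨w, hw⟩ := hA j (Pi.single q 1) fun i => (Fin.cast h i).elim0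
  refine ha ((Ideal.eq_top_iff_one _).2 ?_)
  have := hw q
  rw [Pi.single_eq_same] at this
  rw [this]
  exact Ideal.sum_mem _ fun l _ => Ideal.mul_mem_right _ _ (F.mem _ _ _)

end MinRes

/-! ### The Auslander–Reiten property under flat base change and modulo a regular element. -/

/-- A ring has the Auslander-Reiten property with respect to an ideal `𝔞` if every module resolved
with matrices over `𝔞`, and without extensions by itself and by the ring, is free. -/
def ARProperty (A : Type u) [CommRing A] (𝔞 : Ideal A) : Prop :=
  ∀ F : MinRes A 𝔞, (∀ j, F.HomExact F.M j) → (∀ j, F.HomExact A j) → F.b 1 = 0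

namespace MinRes

variable {A : Type u} [CommRing A] {𝔞 : Ideal A} (F : MinRes A 𝔞)
  {B : Type u} [CommRing B] [Algebra A B] {𝔟 : Ideal B}

/-- The image of a resolution under a ring homomorphism that preserves its exactness. -/
def map (hab : 𝔞 ≤ 𝔟.comap (algebraMap A B)) (hex : ∀ n, MatExact (F.D n) (F.D (n + 1)) B) :
    MinRes B 𝔟 where
  b := F.b
  D n := (F.D n).map (algebraMap A B)
  mem n i j := hab (F.mem n i j)
  mul_eq_zero n := by
    rw [← Matrix.map_mul, F.mul_eq_zero, Matrix.map_zero _ (map_zero _)]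
  exact n := matExact_map_iff.2 (hex n)

variable (hab : 𝔞 ≤ 𝔟.comap (algebraMap A B)) (hex : ∀ n, MatExact (F.D n) (F.D (n + 1)) B)

theorem map_mulVec_algebraMap (v : Fin (F.b 1) → A) :
    ((F.map hab hex).D 0).mulVecLin ((Algebra.linearMap A B).compLeft _ v) =
      (Algebra.linearMap A B).compLeft _ ((F.D 0).mulVecLin v) := by
  refine funext fun i => ?_
  change ∑ k, algebraMap A B (F.D 0 i k) * algebraMap A B (v k) =
    algebraMap A B (∑ k, F.D 0 i k * v k)
  simp

/-- The comparison between the modules resolved by a resolution and by its image. -/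
def compare : F.M →ₗ[A] (F.map hab hex).M :=
  Submodule.liftQ _ (((Submodule.mkQ (LinearMap.range
    ((F.map hab hex).D 0).mulVecLin)).restrictScalars A).comp
      ((Algebra.linearMap A B).compLeft (Fin (F.b 0)))) (by
    rintro _ ⟨w, rfl⟩
    refine (Submodule.Quotient.mk_eq_zero _).2 ?_
    exact ⟨_, F.map_mulVec_algebraMap hab hex w⟩)

theorem homExact_map_iff (N : Type*) [AddCommGroup N] [Module A N] [Module B N]
    [IsScalarTower A B N] (j : ℕ) : (F.map hab hex).HomExact N j ↔ F.HomExact N j :=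
  matExact_map_iff (P := (F.D (j + 1)).transpose) (Q := (F.D j).transpose)

theorem compare_isBaseChange : IsBaseChange B (F.compare hab hex) := by
  refine IsBaseChange.of_right_exact B ((Algebra.linearMap A B).compLeft (Fin (F.b 1)))
    ((Algebra.linearMap A B).compLeft (Fin (F.b 0))) (F.compare hab hex)
    (f := (F.D 0).mulVecLin) (g := Submodule.mkQ _)
    (f' := ((F.map hab hex).D 0).mulVecLin) (g' := Submodule.mkQ _) ?_ ?_
    ((IsBaseChange.linearMap A B).finitePow _) ((IsBaseChange.linearMap A B).finitePow _)
    ?_ (Submodule.mkQ_surjective _) ?_ (Submodule.mkQ_surjective _)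
  · refine LinearMap.ext fun v => ?_
    exact (F.map_mulVec_algebraMap hab hex v).symm
  · rfl
  · exact LinearMap.exact_map_mkQ_range _
  · exact LinearMap.exact_map_mkQ_range _

theorem matExact_of_flat [Module.Flat A B] (n : ℕ) : MatExact (F.D n) (F.D (n + 1)) B :=
  matExact_map_iff.1 (((F.exact n).baseChange (B := B) (F.mul_eq_zero n)).of_linearEquiv
    (TensorProduct.AlgebraTensorModule.rid A B B))

end MinRes

variable {A : Type u} [CommRing A] {𝔞 : Ideal A} {B : Type u} [CommRing B] [Algebra A B]
  {𝔟 : Ideal B}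

theorem ARProperty.of_flat [Module.Flat A B] (hab : 𝔞 ≤ 𝔟.comap (algebraMap A B))
    (h : ARProperty B 𝔟) : ARProperty A 𝔞 := by
  intro F hM hA
  have hex := F.matExact_of_flat (B := B)
  have bc {N : Type u} [AddCommGroup N] [Module A N] (j : ℕ) (hN : F.HomExact N j) :
      (F.map hab hex).HomExact (TensorProduct A B N) j :=
    MatExact.baseChange (B := B) (F.transpose_mul j) hN
  exact h (F.map hab hex)
    (fun j => (bc j (hM j)).of_linearEquiv (F.compare_isBaseChange hab hex).equiv)
    (fun j => (bc j (hA j)).of_linearEquiv (TensorProduct.AlgebraTensorModule.rid A B B))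

namespace MinRes

variable (F : MinRes A 𝔞)

theorem compare_surjective (hab : 𝔞 ≤ 𝔟.comap (algebraMap A B))
    (hex : ∀ n, MatExact (F.D n) (F.D (n + 1)) B)
    (hs : Function.Surjective (algebraMap A B)) : Function.Surjective (F.compare hab hex) := by
  intro z
  obtain ⟨v, rfl⟩ := Submodule.Quotient.mk_surjective _ z
  choose w hw using fun i => hs (v i)
  refine ⟨Submodule.Quotient.mk w, ?_⟩
  exact congrArg Submodule.Quotient.mk (funext hw)

/-- Modulo `x`, the resolved module becomes its quotient by the multiples of `x`. -/
theorem exact_smul_compare (hab : 𝔞 ≤ 𝔟.comap (algebraMap A B))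
    (hex : ∀ n, MatExact (F.D n) (F.D (n + 1)) B)
    (hs : Function.Surjective (algebraMap A B)) {x : A}
    (hx : RingHom.ker (algebraMap A B) = Ideal.span {x}) :
    Function.Exact (LinearMap.lsmul A F.M x) (F.compare hab hex) := by
  have hx0 : algebraMap A B x = 0 := by
    rw [← RingHom.mem_ker, hx]; exact Ideal.mem_span_singleton_self x
  intro z
  constructor
  · intro hz
    obtain ⟨v, rfl⟩ := Submodule.Quotient.mk_surjective _ z
    obtain ⟨w, hw⟩ : ∃ w : Fin (F.b 1) → B, ((F.map hab hex).D 0).mulVecLin w =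
        (Algebra.linearMap A B).compLeft _ v := (Submodule.Quotient.mk_eq_zero _).1 hz
    choose w' hw' using fun i => hs (w i)
    obtain rfl : (Algebra.linearMap A B).compLeft _ w' = w := funext hw'
    replace hw := (F.map_mulVec_algebraMap hab hex w').symm.trans hw
    have hmem (i) : v i - (F.D 0).mulVecLin w' i ∈ Ideal.span {x} := by
      rw [← hx, RingHom.mem_ker, map_sub, sub_eq_zero]
      exact (congrFun hw i).symm
    choose u hu using fun i => Ideal.mem_span_singleton'.1 (hmem i)
    refine ⟨Submodule.Quotient.mk u, ?_⟩
    rw [LinearMap.lsmul_apply, ← Submodule.Quotient.mk_smul]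
    have hd : v - x • u ∈ LinearMap.range (F.D 0).mulVecLin := by
      refine ⟨w', funext fun i => ?_⟩
      have := hu i
      simp only [Pi.sub_apply, Pi.smul_apply, smul_eq_mul]
      linear_combination this
    exact ((Submodule.Quotient.eq _).2 hd).symm
  · rintro ⟨y, rfl⟩
    rw [LinearMap.lsmul_apply, map_smul, ← algebraMap_smul B x, hx0, zero_smul]

/-- This is `Tor_i(M, A / x) = 0` for `i ≥ 2`. A cycle modulo `x` lifts to `v'` with `D v' = x u`;
regularity makes `u` a cycle, so `u = D t`, and `v' - x t` is a genuine cycle. The shift is needed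
because `x` may be a zero divisor on `M` itself. -/
theorem matExact_shift_of_regular (hs : Function.Surjective (algebraMap A B)) {x : A}
    (hx : RingHom.ker (algebraMap A B) = Ideal.span {x}) (hreg : ∀ a, x * a = 0 → a = 0) (n : ℕ) :
    MatExact (F.shift.D n) (F.shift.D (n + 1)) B := by
  suffices MatExact (F.D (n + 1)) (F.D (n + 2)) B from this
  intro v hv
  choose v' hv' using fun i => hs (v i)
  have hmem (i) : ∑ k, F.D (n + 1) i k • v' k ∈ Ideal.span {x} := by
    rw [← hx, RingHom.mem_ker, map_sum]
    simp only [smul_eq_mul, map_mul]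
    rw [← hv i]
    refine Finset.sum_congr rfl fun k _ => ?_
    rw [hv', Algebra.smul_def]
  choose u hu using fun i => Ideal.mem_span_singleton'.1 (hmem i)
  obtain ⟨t, ht⟩ := F.exact n u fun i => hreg _ (by
    have := matAction_mul_apply (F.mul_eq_zero n) v' i
    simp_rw [← hu] at this
    rw [← this, Finset.mul_sum]
    refine Finset.sum_congr rfl fun k _ => ?_
    simp only [smul_eq_mul]; ring)
  obtain ⟨s, hs'⟩ := F.exact (n + 1) (fun k => v' k - x * t k) fun i => by
    simp only [smul_sub, Finset.sum_sub_distrib]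
    rw [← hu, ht, sub_eq_zero, Finset.sum_mul]
    refine Finset.sum_congr rfl fun k _ => ?_
    simp only [smul_eq_mul]; ring
  have hx0 : algebraMap A B x = 0 := by
    rw [← RingHom.mem_ker, hx]; exact Ideal.mem_span_singleton_self x
  refine ⟨fun k => algebraMap A B (s k), fun k => ?_⟩
  have := congrArg (algebraMap A B) (hs' k)
  rw [map_sub, hv', map_mul, hx0, zero_mul, sub_zero, map_sum] at this
  rw [this]
  refine Finset.sum_congr rfl fun k _ => ?_
  rw [Algebra.smul_def (A := B), smul_eq_mul, map_mul]

end MinRes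

/-- The Auslander-Reiten property lifts from the quotient by a regular element. -/
theorem ARProperty.of_regular (hab : 𝔞 ≤ 𝔟.comap (algebraMap A B)) (ha : 𝔞 ≠ ⊤)
    (hs : Function.Surjective (algebraMap A B)) {x : A}
    (hx : RingHom.ker (algebraMap A B) = Ideal.span {x}) (hreg : ∀ a, x * a = 0 → a = 0)
    (h : ARProperty B 𝔟) : ARProperty A 𝔞 := by
  intro F hM hA
  have hex := F.matExact_shift_of_regular hs hx hreg
  have hinjA : Function.Injective (LinearMap.lsmul A A x) :=
    (injective_iff_map_eq_zero _).2 hreg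
  -- The first syzygy lies in a free module, so `x` is regular on it.
  have hinjM : Function.Injective (LinearMap.lsmul A F.shift.M x) := by
    refine (injective_iff_map_eq_zero _).2 fun z hz => F.syzygyMap_injective ?_
    ext i
    have := congrFun (congrArg F.syzygyMap hz) i
    simp only [LinearMap.lsmul_apply, map_smul, map_zero] at this
    simpa using hreg _ this
  have hM' := F.homExact_shift hM hA
  have hexA : Function.Exact (LinearMap.lsmul A A x) (Algebra.linearMap A B) := by
    intro a
    rw [Algebra.linearMap_apply, ← RingHom.mem_ker, hx, Ideal.mem_span_singleton']
    simp [mul_comm, eq_comm]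
  -- The property of `B` yields `F.b 2 = 0`, one step beyond the goal. Its Ext hypotheses come from
  -- `0 → N → N → N / x N → 0`, for `N` the syzygy and for `N = A`.
  refine F.b_eq_zero_of_succ ha hA (h (F.shift.map hab hex) (fun j => ?_) (fun j => ?_))
  · exact (F.shift.homExact_map_iff hab hex _ j).2 (MinRes.HomExact.right hinjM
      (F.shift.exact_smul_compare hab hex hs hx) (F.shift.compare_surjective hab hex hs)
      (hM' j) (hM' (j + 1)))
  · exact (F.shift.homExact_map_iff hab hex _ j).2 (MinRes.HomExact.right hinjA
      hexA hs (hA (j + 1)) (hA (j + 2)))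

/-! ### Quotients by Burch ideals. -/

theorem IsBurchIdeal.exists_mul_not_mem {S : Type u} [CommRing S] [IsLocalRing S] {I : Ideal S}
    (hI : IsBurchIdeal I) : ∃ x ∈ maximalIdeal S, ∃ y : S,
      (∀ z ∈ maximalIdeal S, z * y ∈ I) ∧ x * y ∉ maximalIdeal S * I := by
  by_contra! hcon
  have hcol (y : S) (hy : y ∈ Submodule.colon I (maximalIdeal S : Set S)) :
      ∀ z ∈ maximalIdeal S, z * y ∈ I := fun z hz => by
    simpa [mul_comm] using Submodule.mem_colon.1 hy z hz
  refine hI (le_antisymm (Ideal.mul_mono_right fun i hi => Submodule.mem_colon.2 fun z _ =>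
    I.mul_mem_right z hi) (Ideal.mul_le.2 fun x hx y hy => hcon x hx y (hcol y hy)))

/-- A ring of the form `S / I` with `I` a Burch ideal has the Auslander-Reiten property. -/
theorem ARProperty.of_isBurchIdeal {S : Type u} [CommRing S] [IsLocalRing S] (f : S →+* A)
    (hf : Function.Surjective f) (hI : IsBurchIdeal (RingHom.ker f)) (ha : 𝔞 ≠ ⊤) :
    ARProperty A 𝔞 := by
  obtain ⟨x, hx, y, hy, hxy⟩ := hI.exists_mul_not_mem
  intro F hM hA
  have han : 𝔞.comap f ≤ maximalIdeal S := le_maximalIdeal fun h => ha <| by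
    rw [← Ideal.map_comap_of_surjective f hf 𝔞, h, Ideal.map_top]
  have hker {s : S} (hs : f s ∈ 𝔞) : s ∈ maximalIdeal S := han hs
  have hzy (a : A) (h : a ∈ 𝔞) : a * f y = 0 := by
    obtain ⟨s, rfl⟩ := hf a
    rw [← map_mul]
    exact hy s (hker h)
  by_cases h1 : F.b 1 = 0
  · exact h1
  suffices h4 : F.b 4 = 0 from F.b_eq_zero_of_succ ha hA (F.b_eq_zero_of_succ ha hA
    (F.b_eq_zero_of_succ ha hA h4))
  by_contra h4
  let p : Fin (F.b 1) := ⟨0, Nat.pos_of_ne_zero h1⟩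
  let q : Fin (F.b 4) := ⟨0, Nat.pos_of_ne_zero h4⟩
  -- For the second syzygy `N`, `hN 0` and `hN 1` are `Ext¹(N, N) = 0` and `Ext²(N, N) = 0`.
  have hN := F.shift.homExact_shift (F.homExact_shift hM hA) (fun j => hA (j + 1))
  let ι : F.shift.shift.M →ₗ[A] (Fin (F.b 1) → A) := F.shift.syzygyMap
  have hι : Function.Injective ι := F.shift.syzygyMap_injective
  have hιmem (z) (i) : ι z i ∈ 𝔞 := F.shift.syzygyMap_mem z i
  -- The entries of `D 0` kill `f y`, so `y e_p` is a cycle in `F₁`, that is, an element of `N`.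
  obtain ⟨c, hc⟩ : ∃ c, ι c = Pi.single p (f y) := by
    obtain ⟨c, hc⟩ := F.exact 0 (Pi.single p (f y)) fun i => by
      rw [Finset.sum_eq_single p (by intro k _ hk; simp [hk]) (by simp)]
      simpa using hzy _ (F.mem 0 i p)
    exact ⟨Submodule.Quotient.mk c, funext fun k => (hc k).symm⟩
  obtain ⟨ψ, hψ⟩ : ∃ ψ : Fin (F.b 3) → F.shift.shift.M, ∀ k : Fin (F.b 4),
      (Pi.single q c : Fin (F.b 4) → F.shift.shift.M) k = ∑ l, F.D 3 l k • ψ l :=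
    hN 1 (Pi.single q c) fun i => hι <| by
      change ι (∑ k : Fin (F.b 4), F.D 4 k i •
        (Pi.single q c : Fin (F.b 4) → F.shift.shift.M) k) = ι 0
      rw [Finset.sum_eq_single q (by intro k _ hk; simp [hk]) (by simp)]
      ext j
      rw [map_smul, Pi.single_eq_same, hc]
      by_cases hj : j = p
      · subst hj; simpa using hzy _ (F.mem 4 q i)
      · simp [hj]
  obtain ⟨θ, hθ⟩ : ∃ θ : Fin (F.b 2) → F.shift.shift.M, ∀ k : Fin (F.b 3),
      f x • ψ k = ∑ l, F.D 2 l k • θ l :=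
    hN 0 (fun k => f x • ψ k) fun (i : Fin (F.b 4)) => hι <| by
      change ι (∑ k : Fin (F.b 3), F.D 3 k i • f x • ψ k) = ι 0
      simp_rw [smul_comm _ (f x)]
      rw [← Finset.smul_sum, ← hψ i, map_smul, map_zero]
      have hxy0 : f x * f y = 0 := by rw [← map_mul]; exact hy x hx
      by_cases hi : i = q
      · subst hi
        rw [Pi.single_eq_same, hc]
        ext j
        by_cases hj : j = p
        · subst hj; simpa using hxy0
        · simp [hj]
      · simp [hi]
  -- compare the two factorizations after lifting all coefficients to `S`
  choose D2 hD2 using fun l k => hf (F.D 2 l k)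
  choose D3 hD3 using fun l k => hf (F.D 3 l k)
  choose ψ' hψ' using fun k => hf (ι (ψ k) p)
  choose θ' hθ' using fun k => hf (ι (θ k) p)
  have hD3m (l k) : D3 l k ∈ maximalIdeal S := hker (by rw [hD3]; exact F.mem _ _ _)
  -- Here `N ⊆ 𝔞 F₁` enters: it supplies the factor in `𝔫` for the last sum in `key`.
  have hθm (k) : θ' k ∈ maximalIdeal S := hker (by rw [hθ']; exact hιmem _ _)
  have e1 : y - ∑ i, D3 i q * ψ' i ∈ RingHom.ker f := by
    rw [RingHom.mem_ker, map_sub, sub_eq_zero, map_sum]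
    have := congrFun (congrArg ι (hψ q)) p
    rw [Pi.single_eq_same, hc] at this
    simpa [hD3, hψ'] using this
  have e2 (i) : x * ψ' i - ∑ l, D2 l i * θ' l ∈ RingHom.ker f := by
    rw [RingHom.mem_ker, map_sub, sub_eq_zero, map_sum]
    have := congrFun (congrArg ι (hθ i)) p
    simpa [hD2, hψ', hθ'] using this
  have e3 (l) : ∑ i, D2 l i * D3 i q ∈ RingHom.ker f := by
    rw [RingHom.mem_ker, map_sum]
    have := congrFun (congrFun (F.mul_eq_zero 2) l) q
    simpa [hD2, hD3, Matrix.mul_apply] using this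
  have key : x * y = x * (y - ∑ i, D3 i q * ψ' i) +
      (∑ i, D3 i q * (x * ψ' i - ∑ l, D2 l i * θ' l) +
        ∑ l, θ' l * ∑ i, D2 l i * D3 i q) := by
    have h1 : ∑ i, D3 i q * ∑ l, D2 l i * θ' l = ∑ l, θ' l * ∑ i, D2 l i * D3 i q := by
      simp_rw [Finset.mul_sum]
      rw [Finset.sum_comm]
      exact Finset.sum_congr rfl fun l _ => Finset.sum_congr rfl fun i _ => by ring
    have h2 : ∑ i, D3 i q * (x * ψ' i) = x * ∑ i, D3 i q * ψ' i := by
      rw [Finset.mul_sum]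
      exact Finset.sum_congr rfl fun i _ => by ring
    simp_rw [mul_sub, Finset.sum_sub_distrib]
    rw [h1, h2]
    ring
  refine hxy (key ▸ ?_)
  refine add_mem (Ideal.mul_mem_mul hx e1) (add_mem ?_ ?_)
  · exact Ideal.sum_mem _ fun i _ => Ideal.mul_mem_mul (hD3m i q) (e2 i)
  · exact Ideal.sum_mem _ fun l _ => Ideal.mul_mem_mul (hθm l) (e3 l)

/-! ### Induction along a regular sequence. -/

theorem map_mk_maximalIdeal_ne_top {A : Type*} [CommRing A] [IsLocalRing A] {J : Ideal A}
    (hJ : J ≤ maximalIdeal A) : (maximalIdeal A).map (Ideal.Quotient.mk J) ≠ ⊤ := by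
  intro htop
  have hc := Ideal.comap_map_of_surjective' _ (Ideal.Quotient.mk_surjective (I := J))
    (maximalIdeal A)
  rw [htop, Ideal.comap_top, Ideal.mk_ker, sup_eq_left.2 hJ] at hc
  exact (IsLocalRing.maximalIdeal.isMaximal A).ne_top hc.symm

/-- The Auslander-Reiten property lifts from the quotient by a regular sequence. -/
theorem ARProperty.of_isWeaklyRegular {A : Type u} [CommRing A] [IsLocalRing A] {rs : List A}
    (hrs : RingTheory.Sequence.IsWeaklyRegular A rs) (hmem : ∀ r ∈ rs, r ∈ maximalIdeal A)
    (h : ARProperty (A ⧸ Ideal.ofList rs)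
      ((maximalIdeal A).map (Ideal.Quotient.mk (Ideal.ofList rs)))) :
    ARProperty A (maximalIdeal A) := by
  let J (i : ℕ) : Ideal A := Ideal.ofList (rs.take i)
  have hJm (i : ℕ) : J i ≤ maximalIdeal A :=
    Ideal.span_le.2 fun r hr => hmem r (List.mem_of_mem_take hr)
  have step (i : ℕ) (hi : i < rs.length)
      (hAR : ARProperty (A ⧸ J (i + 1)) ((maximalIdeal A).map (Ideal.Quotient.mk (J (i + 1))))) :
      ARProperty (A ⧸ J i) ((maximalIdeal A).map (Ideal.Quotient.mk (J i))) := by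
    have hJ : J (i + 1) = Ideal.span {rs[i]} ⊔ J i := by
      simp only [J]
      rw [← List.take_concat_get' rs i hi, Ideal.ofList_append, Ideal.ofList_singleton, sup_comm]
    have hle : J i ≤ J (i + 1) := hJ ▸ le_sup_right
    let _ : Algebra (A ⧸ J i) (A ⧸ J (i + 1)) := (Ideal.Quotient.factor hle).toAlgebra
    have hal : algebraMap (A ⧸ J i) (A ⧸ J (i + 1)) = Ideal.Quotient.factor hle := rfl
    refine ARProperty.of_regular (x := Ideal.Quotient.mk (J i) rs[i]) ?_
      (map_mk_maximalIdeal_ne_top (hJm i))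
      (Ideal.Quotient.factor_surjective hle) ?_ ?_ hAR
    · rw [← Ideal.map_le_iff_le_comap, hal, Ideal.map_map, Ideal.Quotient.factor_comp_mk]
    · ext z
      obtain ⟨a, rfl⟩ := Ideal.Quotient.mk_surjective z
      rw [RingHom.mem_ker, hal, Ideal.Quotient.factor_mk, Ideal.Quotient.eq_zero_iff_mem, hJ,
        ← Set.image_singleton, ← Ideal.map_span, Ideal.mem_quotient_iff_mem_sup]
    · intro z hz
      obtain ⟨a, rfl⟩ := Ideal.Quotient.mk_surjective z
      rw [← map_mul, Ideal.Quotient.eq_zero_iff_mem] at hz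
      have hreg := (isSMulRegular_quotient_iff_mem_of_smul_mem _ _).1 (hrs.regular_mod_prev i hi) a
      simp only [smul_eq_mul, Ideal.mul_top] at hreg
      exact Ideal.Quotient.eq_zero_iff_mem.2 (hreg hz)
  have h0 : ∀ i, i ≤ rs.length →
      ARProperty (A ⧸ J i) ((maximalIdeal A).map (Ideal.Quotient.mk (J i))) →
      ARProperty (A ⧸ J 0) ((maximalIdeal A).map (Ideal.Quotient.mk (J 0))) := by
    intro i
    induction i with
    | zero => exact fun _ h => h
    | succ i ih => exact fun hi h => ih (by omega) (step i (by omega) h)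
  have hlen : J rs.length = Ideal.ofList rs := by simp [J]
  have hfin := h0 rs.length le_rfl (hlen ▸ h)
  have hbot : J 0 = ⊥ := by simp [J]
  -- `A ⧸ ⊥` is another ring than `A`; flat descent along `A → A ⧸ ⊥` bridges the two.
  have : Module.Flat A (A ⧸ J 0) := .of_linearEquiv (Submodule.quotEquivOfEqBot (J 0) hbot)
  exact hfin.of_flat Ideal.le_comap_map

/-! ### Minimal resolutions over a local ring and their relation to Ext. -/

section Resolution

variable {R : Type u} [CommRing R]

theorem exists_surjective_of_isUnit {M : Type*} [AddCommGroup M] [Module R M] {m : ℕ}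
    {g : (Fin (m + 1) → R) →ₗ[R] M} (hg : Function.Surjective g) {v : Fin (m + 1) → R}
    (hv : g v = 0) {i : Fin (m + 1)} (hi : IsUnit (v i)) :
    ∃ g' : (Fin m → R) →ₗ[R] M, Function.Surjective g' := by
  obtain ⟨c, hc⟩ := hi.exists_left_inv
  let h : (Fin m → R) →ₗ[R] (Fin (m + 1) → R) := LinearMap.pi fun k =>
    i.insertNth (α := fun _ => (Fin m → R) →ₗ[R] R) 0 (fun j => LinearMap.proj j) k
  refine ⟨g.comp h, fun z => ?_⟩
  obtain ⟨u, rfl⟩ := hg z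
  -- Subtracting this multiple of the relation `v` clears coordinate `i` without changing the image
  -- under `g`.
  refine ⟨fun j => (u - (u i * c) • v) (i.succAbove j), ?_⟩
  have : h (fun j => (u - (u i * c) • v) (i.succAbove j)) = u - (u i * c) • v := by
    ext k
    induction k using Fin.succAboveCases i with
    | x => simp [h, mul_assoc, hc]
    | p j => simp [h]
  rw [LinearMap.comp_apply, this, map_sub, map_smul, hv, smul_zero, sub_zero]

/-- With the least number of generators, no relation has a unit coordinate, since that generator
could be dropped. -/
theorem exists_minimal_cover [IsLocalRing R] (M : Type u) [AddCommGroup M] [Module R M]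
    [Module.Finite R M] : ∃ (n : ℕ) (g : (Fin n → R) →ₗ[R] M), Function.Surjective g ∧
      ∀ v, g v = 0 → ∀ i, v i ∈ maximalIdeal R := by
  classical
  have hex : ∃ n, ∃ g : (Fin n → R) →ₗ[R] M, Function.Surjective g :=
    Module.Finite.exists_fin' R M
  have hmin (m : ℕ) (hm : m < Nat.find hex) := Nat.find_min hex hm
  obtain ⟨g, hg⟩ := Nat.find_spec hex
  refine ⟨Nat.find hex, g, hg, fun v hv i => ?_⟩
  by_contra hi
  have hu : IsUnit (v i) := by simpa using hi
  generalize Nat.find hex = n at *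
  cases n with
  | zero => exact i.elim0
  | succ m => exact hmin m m.lt_succ_self (exists_surjective_of_isUnit hg hv hu)

/-- A sequence of successive syzygies with covers by finite free modules. -/
structure SyzygySequence (R : Type u) [CommRing R] (𝔞 : Ideal R) where
  X : ℕ → ModuleCat.{u} R
  b : ℕ → ℕ
  π : ∀ n, (Fin (b n) → R) →ₗ[R] X n
  ι : ∀ n, X (n + 1) →ₗ[R] (Fin (b n) → R)
  π_surjective : ∀ n, Function.Surjective (π n)
  ι_injective : ∀ n, Function.Injective (ι n)
  exact : ∀ n, Function.Exact (ι n) (π n)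
  mem : ∀ n z i, ι n z i ∈ 𝔞

theorem exists_syzygySequence [IsLocalRing R] [IsNoetherianRing R] (M : Type u) [AddCommGroup M]
    [Module R M] [Module.Finite R M] :
    ∃ T : SyzygySequence R (maximalIdeal R), T.X 0 = ModuleCat.of R M := by
  choose n g hg hmem using fun X : {X : ModuleCat.{u} R // Module.Finite R X} =>
    have := X.2
    exists_minimal_cover (R := R) X.1
  let next (X : {X : ModuleCat.{u} R // Module.Finite R X}) :
      {X : ModuleCat.{u} R // Module.Finite R X} :=
    ⟨ModuleCat.of R (LinearMap.ker (g X)),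
      inferInstanceAs (Module.Finite R (LinearMap.ker (g X)))⟩
  let Y : ℕ → {X : ModuleCat.{u} R // Module.Finite R X} :=
    fun k => Nat.rec ⟨ModuleCat.of R M, inferInstanceAs (Module.Finite R M)⟩ (fun _ => next) k
  exact ⟨{
    X k := (Y k).1
    b k := n (Y k)
    π k := g (Y k)
    ι k := (LinearMap.ker (g (Y k))).subtype
    π_surjective k := hg (Y k)
    ι_injective k := Submodule.subtype_injective _
    exact k := LinearMap.exact_subtype_ker_map (g (Y k))
    mem k z := hmem (Y k) z.1 z.2 }, rfl⟩

namespace SyzygySequence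

variable {𝔞 : Ideal R} (T : SyzygySequence R 𝔞)

/-- The matrices of the resolution spliced from a sequence of syzygies. -/
def matrix (n : ℕ) : Matrix (Fin (T.b n)) (Fin (T.b (n + 1))) R :=
  LinearMap.toMatrix' ((T.ι n).comp (T.π (n + 1)))

theorem matrix_mulVec (n : ℕ) (v : Fin (T.b (n + 1)) → R) :
    (T.matrix n).mulVec v = T.ι n (T.π (n + 1) v) :=
  LinearMap.toMatrix'_mulVec _ _

theorem matrix_apply (n : ℕ) (i : Fin (T.b n)) (j : Fin (T.b (n + 1))) :
    T.matrix n i j = T.ι n (T.π (n + 1) (Pi.single j 1)) i := by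
  rw [matrix, LinearMap.toMatrix'_apply, LinearMap.comp_apply]

/-- The resolution spliced from a sequence of syzygies. -/
def toMinRes : MinRes R 𝔞 where
  b := T.b
  D := T.matrix
  mem n i j := by rw [matrix_apply]; exact T.mem _ _ _
  mul_eq_zero n := by
    refine Matrix.toLin'.injective (LinearMap.ext fun v => ?_)
    rw [Matrix.toLin'_mul, LinearMap.comp_apply, Matrix.toLin'_apply, Matrix.toLin'_apply,
      matrix_mulVec, matrix_mulVec, (T.exact (n + 1)).apply_apply_eq_zero]
    simp
  exact n v hv := by
    have h : T.ι n (T.π (n + 1) v) = 0 := by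
      rw [← matrix_mulVec]; exact funext hv
    obtain ⟨z, hz⟩ := (T.exact (n + 1) v).1 (T.ι_injective n (by rw [h, map_zero]))
    obtain ⟨w, rfl⟩ := T.π_surjective (n + 2) z
    rw [← matrix_mulVec] at hz
    exact ⟨w, fun k => (congrFun hz k).symm⟩

theorem range_matrix_zero :
    LinearMap.range (T.matrix 0).mulVecLin = LinearMap.ker (T.π 0) := by
  ext v
  rw [LinearMap.mem_ker, T.exact 0 v]
  constructor
  · rintro ⟨w, rfl⟩
    exact ⟨T.π 1 w, (T.matrix_mulVec 0 w).symm⟩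
  · rintro ⟨z, rfl⟩
    obtain ⟨w, rfl⟩ := T.π_surjective 1 z
    exact ⟨w, T.matrix_mulVec 0 w⟩

/-- The module resolved by the spliced resolution. -/
noncomputable def equivModule : T.toMinRes.M ≃ₗ[R] T.X 0 :=
  (Submodule.quotEquivOfEq _ _ T.range_matrix_zero).trans
    ((T.π 0).quotKerEquivOfSurjective (T.π_surjective 0))

/-- The short exact sequence of a syzygy. -/
def shortComplex (n : ℕ) : CategoryTheory.ShortComplex (ModuleCat.{u} R) :=
  CategoryTheory.ShortComplex.mk (X₁ := T.X (n + 1)) (X₂ := ModuleCat.of R (Fin (T.b n) → R))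
    (X₃ := T.X n) (ModuleCat.ofHom (T.ι n)) (ModuleCat.ofHom (T.π n)) (by
      ext z; exact (T.exact n).apply_apply_eq_zero z)

theorem shortExact (n : ℕ) : (T.shortComplex n).ShortExact :=
  ModuleCat.shortComplex_shortExact _ (T.exact n) (T.ι_injective n) (T.π_surjective n)

open CategoryTheory Abelian in
-- Dimension shifting: for `j > 0`, `Ext^j(X (n+1), N)` embeds in `Ext^{j+1}(X n, N)` because the
-- middle term is projective.
theorem subsingleton_ext (N : ModuleCat.{u} R)
    (h : ∀ j : ℕ, 0 < j → Subsingleton (Ext (T.X 0) N j)) (n : ℕ) :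
    ∀ j : ℕ, 0 < j → Subsingleton (Ext (T.X n) N j) := by
  induction n with
  | zero => exact h
  | succ n ih =>
    intro j hj
    obtain ⟨j, rfl⟩ := Nat.exists_eq_succ_of_ne_zero hj.ne'
    refine subsingleton_of_forall_eq 0 fun x => ?_
    have := ih (1 + (j + 1)) (by omega)
    obtain ⟨y, rfl⟩ := Ext.contravariant_sequence_exact₁ (T.shortExact n) N x rfl
      (Subsingleton.elim (α := Ext (T.X n) N _) _ _)
    have : Projective (T.shortComplex n).X₂ :=
      inferInstanceAs (Projective (ModuleCat.of R (Fin (T.b n) → R)))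
    rw [Ext.eq_zero_of_projective y, Ext.comp_zero]
    rfl

open CategoryTheory Abelian in
theorem exists_extension (N : ModuleCat.{u} R) (n : ℕ) (h : Subsingleton (Ext (T.X n) N 1))
    (φ : T.X (n + 1) →ₗ[R] N) : ∃ ψ : (Fin (T.b n) → R) →ₗ[R] N, ψ.comp (T.ι n) = φ := by
  obtain ⟨y, hy⟩ := Ext.contravariant_sequence_exact₁ (T.shortExact n) N
    (Ext.mk₀ (ModuleCat.ofHom φ)) (n₁ := 1) rfl (Subsingleton.elim (α := Ext (T.X n) N _) _ _)
  obtain ⟨ψ, rfl⟩ := Ext.homEquiv₀.symm.surjective y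
  refine ⟨ψ.hom, ?_⟩
  change (Ext.mk₀ (T.shortComplex n).f).comp (Ext.mk₀ ψ) _ = _ at hy
  rw [Ext.mk₀_comp_mk₀] at hy
  have := Ext.homEquiv₀.symm.injective hy
  exact congrArg ModuleCat.Hom.hom this

/-- A cocycle on `F_{j+1}` factors through the syzygy `X (j+1)`; `Ext¹(X j, N) = 0` extends the
resulting map to `F_j`, which exhibits a coboundary. -/
theorem homExact (N : Type u) [AddCommGroup N] [Module R N]
    (h : ∀ j : ℕ, 0 < j → Subsingleton (CategoryTheory.Abelian.Ext (T.X 0) (ModuleCat.of R N) j))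
    (j : ℕ) : T.toMinRes.HomExact N j := by
  suffices MatExact (T.matrix (j + 1)).transpose (T.matrix j).transpose N from this
  intro φ hφ
  let Φ : (Fin (T.b (j + 1)) → R) →ₗ[R] N := Fintype.linearCombination R φ
  have hΦ0 : Φ.comp ((T.ι (j + 1)).comp (T.π (j + 2))) = 0 := by
    refine LinearMap.pi_ext' fun i => LinearMap.ext_ring ?_
    rw [LinearMap.comp_apply, LinearMap.zero_comp, LinearMap.zero_apply, ← hφ i]
    simp only [LinearMap.single_apply, LinearMap.comp_apply, Φ, Fintype.linearCombination_apply,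
      Matrix.transpose_apply, matrix_apply]
  have hΦ1 : LinearMap.ker (T.π (j + 1)) ≤ LinearMap.ker Φ := by
    intro v hv
    obtain ⟨z, rfl⟩ := (T.exact (j + 1) v).1 hv
    obtain ⟨w, rfl⟩ := T.π_surjective (j + 2) z
    exact LinearMap.congr_fun hΦ0 w
  let e := (T.π (j + 1)).quotKerEquivOfSurjective (T.π_surjective (j + 1))
  obtain ⟨ψ, hψ⟩ := T.exists_extension (ModuleCat.of R N) j
    (T.subsingleton_ext _ h j 1 one_pos) ((Submodule.liftQ _ Φ hΦ1).comp e.symm.toLinearMap)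
  have hΨ (v) : Φ v = ψ (T.ι j (T.π (j + 1) v)) := by
    rw [← LinearMap.comp_apply, hψ, LinearMap.comp_apply]
    have : e.symm (T.π (j + 1) v) = Submodule.Quotient.mk v := by
      rw [LinearEquiv.symm_apply_eq]; rfl
    simp [this]
  refine ⟨fun l => ψ (Pi.single l 1), fun k => ?_⟩
  have h1 : φ k = Φ (Pi.single k 1) := by simp [Φ, Fintype.linearCombination_apply_single]
  rw [h1, hΨ, LinearMap.pi_apply_eq_sum_univ ψ]
  refine Finset.sum_congr rfl fun l _ => ?_
  rw [Matrix.transpose_apply, matrix_apply]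
  congr 2
  ext i
  simp [Pi.single_apply, eq_comm]

theorem free_of_b_eq_zero (h : T.b 1 = 0) : Module.Free R (T.X 0) := by
  have hinj : Function.Injective (T.π 0) := by
    rw [injective_iff_map_eq_zero]
    intro v hv
    obtain ⟨z, rfl⟩ := (T.exact 0 v).1 hv
    obtain ⟨w, rfl⟩ := T.π_surjective 1 z
    have : w = 0 := funext fun i => (Fin.cast h i).elim0
    rw [this, map_zero, map_zero]
  exact Module.Free.of_equiv (LinearEquiv.ofBijective (T.π 0) ⟨hinj, T.π_surjective 0⟩)

end SyzygySequence

end Resolution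

/-! ### Conclusion for Burch rings. -/

/-- The Auslander-Reiten property of a local ring in terms of extension groups. -/
theorem ARProperty.free {R : Type u} [CommRing R] [IsLocalRing R] [IsNoetherianRing R]
    (hR : ARProperty R (maximalIdeal R)) (M : Type u) [AddCommGroup M] [Module R M]
    [Module.Finite R M]
    (hMM : ∀ j : ℕ, 0 < j →
      Subsingleton (CategoryTheory.Abelian.Ext (ModuleCat.of R M) (ModuleCat.of R M) j))
    (hMR : ∀ j : ℕ, 0 < j →
      Subsingleton (CategoryTheory.Abelian.Ext (ModuleCat.of R M) (ModuleCat.of R R) j)) :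
    Module.Free R M := by
  obtain ⟨T, hT⟩ := exists_syzygySequence (R := R) M
  rw [← hT] at hMM hMR
  have hfree := T.free_of_b_eq_zero (hR T.toMinRes
    (fun j => MatExact.of_linearEquiv (T.homExact (T.X 0) hMM j) T.equivModule.symm)
    (fun j => T.homExact R hMR j))
  rw [hT] at hfree
  exact hfree

theorem IsBurchRing.arProperty {R : Type u} [CommRing R] [IsLocalRing R] [IsNoetherianRing R]
    (hR : IsBurchRing R) : ARProperty R (maximalIdeal R) := by
  obtain ⟨rs, -, hrs, S, _, _, I, hI, ⟨e⟩⟩ := hR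
  let f : S →+* (AdicCompletion (maximalIdeal R) R ⧸ Ideal.ofList rs) :=
    (e.symm : (S ⧸ I) →+* _).comp (Ideal.Quotient.mk I)
  have hf : Function.Surjective f := e.symm.surjective.comp Ideal.Quotient.mk_surjective
  have hker : RingHom.ker f = I := by
    ext s
    simp [f, RingHom.mem_ker, Ideal.Quotient.eq_zero_iff_mem]
  have hle : Ideal.ofList rs ≤ maximalIdeal (AdicCompletion (maximalIdeal R) R) :=
    Ideal.span_le.2 fun r hr => hrs.mem_maximalIdeal r hr
  have hq := ARProperty.of_isBurchIdeal f hf (by rwa [hker])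
    (map_mk_maximalIdeal_ne_top hle)
  have hhat := ARProperty.of_isWeaklyRegular hrs.isRegular.toIsWeaklyRegular
    hrs.mem_maximalIdeal hq
  refine hhat.of_flat ?_
  rw [AdicCompletion.maximalIdeal_eq_map]
  exact Ideal.le_comap_map

theorem mainTheorem2 (R : Type u) [CommRing R] [IsLocalRing R] [IsNoetherianRing R]
    (hCM : IsCohenMacaulayLocal R) (hBurch : IsBurchRing R)
    (M : Type u) [AddCommGroup M] [Module R M] [Module.Finite R M]
    (hMM : ∀ j : ℕ, 0 < j →
      Subsingleton (CategoryTheory.Abelian.Ext (ModuleCat.of R M) (ModuleCat.of R M) j))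
    (hMR : ∀ j : ℕ, 0 < j →
      Subsingleton (CategoryTheory.Abelian.Ext (ModuleCat.of R M) (ModuleCat.of R R) j)) :
    Module.Free R M :=
  hBurch.arProperty.free M hMM hMR
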